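/- Let $T$ be the set of terms defined, simultaneously with a function $S$, as follows: $0\in T$ with $S(0)=-1$; if $\alpha\in T$, $i\in\mathbb N$ and $S(\alpha)\le i+1$, then $\vartheta_i\alpha\in T$ with $S(\vartheta_i\alpha)=i$. Put $\Omega_i:=\vartheta_i0$. Let $k_i(0):=0$, $k_i(\vartheta_j\beta):=\vartheta_j\beta$ if $j\le i$, and $k_i(\vartheta_j\beta):=k_i(\beta)$ if $j>i$. Let $<$ be the least relation on $T$ such that 1. $0<\alpha$ if $\alpha\neq0$; 2. $\vartheta_i\alpha<\vartheta_j\beta$ if $i<j$; 3. $\vartheta_i\alpha<\vartheta_i\beta$ if $\alpha<\beta$ and $k_i\alpha<\vartheta_i\beta$; 4. $\vartheta_i\alpha<\vartheta_i\beta$ if $\beta<\alpha$ and $\vartheta_i\alpha\le k_i\beta$ (that is, $\vartheta_i\alpha<k_i\beta$ or $\vartheta_i\alpha=k_i\beta$). Let $T_{n}[m]$ be the set of those $\alpha\in T$ with $S(\alpha)\le m$ in which only symbols $\vartheta_j$ with $j<n$ occur. Let $\omega_0:=1$ and $\omega_{k+1}:=\omega^{\omega_k}$. Then for every $n\ge1$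 the set $T_{n+1}[0]$ and the initial segment $\{\alpha\in T:\alpha<\vartheta_0\vartheta_1\ldots\vartheta_n\Omega_{n+1}\}$ are well-ordered by $<$, and, writing $\vartheta_0\vartheta_1\ldots\vartheta_n\Omega_{n+1}$ also for the order type of this initial segment, $$\omega_{n+2}\;\le\;\operatorname{otype}(T_{n+1}[0],<)\;=\;\vartheta_0\vartheta_1\ldots\vartheta_n\Omega_{n+1}.$$ -/

import Mathlib

namespace AddFreeTheta

/-- Raw terms built from `0` by formal unary function symbols `ϑ_i` (`i` a natural number). -/
inductive RawTerm : Type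
  | zero : RawTerm
  | theta (i : ℕ) (a : RawTerm) : RawTerm
  deriving DecidableEq

namespace RawTerm

/-- `S 0 = -1` and `S (ϑ_i a) = i`. -/
def S : RawTerm → ℤ
  | zero => -1
  | theta i _ => i

/-- Membership in the set `T`: `0 ∈ T`, and `ϑ_i a ∈ T` iff `a ∈ T` and `S a ≤ i + 1`. -/
def InT : RawTerm → Prop
  | zero => True
  | theta i a => a.InT ∧ a.S ≤ (i : ℤ) + 1

/-- All symbols `ϑ_j` that occur in the term satisfy `j < n`. -/
def LabelsLT (n : ℕ) : RawTerm → Prop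
  | zero => True
  | theta j a => j < n ∧ a.LabelsLT n

/-- The coefficient `k_i`: `k_i 0 = 0`, `k_i (ϑ_j b) = ϑ_j b` if `j ≤ i`, and
`k_i (ϑ_j b) = k_i b` if `j > i`. -/
def k (i : ℕ) : RawTerm → RawTerm
  | zero => zero
  | theta j b => if j ≤ i then theta j b else k i b

/-- The order on terms, as the least relation closed under its defining clauses. The two last
constructors together are the clause "`b < a` and `ϑ_i a ≤ k_i b` imply `ϑ_i a < ϑ_i b`".
Each clause only refers to subterms of the two terms compared, and `T` is closed under subterms,
so the restriction to `T` is the relation that the same clauses define on `T`. -/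
inductive Lt : RawTerm → RawTerm → Prop
  | zero_lt {a : RawTerm} (h : a ≠ zero) : Lt zero a
  | index_lt {i j : ℕ} {a b : RawTerm} (h : i < j) : Lt (theta i a) (theta j b)
  | arg_lt {i : ℕ} {a b : RawTerm} (h : Lt a b) (hk : Lt (k i a) (theta i b)) :
      Lt (theta i a) (theta i b)
  | eq_coeff {i : ℕ} {a b : RawTerm} (h : Lt b a) (hk : theta i a = k i b) :
      Lt (theta i a) (theta i b)
  | lt_coeff {i : ℕ} {a b : RawTerm} (h : Lt b a) (hk : Lt (theta i a) (k i b)) :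
      Lt (theta i a) (theta i b)

/-- `Ω_i = ϑ_i 0`. -/
def Omega (i : ℕ) : RawTerm := theta i zero

/-- `tower i m = ϑ_i ϑ_{i+1} … ϑ_{i+m-1} Ω_{i+m}`, with `m` symbols `ϑ` in front of `Ω_{i+m}`. -/
def tower (i : ℕ) : ℕ → RawTerm
  | 0 => Omega i
  | m + 1 => theta i (tower (i + 1) m)

theorem S_tower (i m : ℕ) : (tower i m).S = i := by
  cases m <;> rfl

theorem inT_tower (i m : ℕ) : (tower i m).InT := by
  induction m generalizing i with
  | zero => exact ⟨trivial, by simp only [S]; omega⟩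
  | succ m ih => exact ⟨ih (i + 1), by rw [S_tower]; push_cast; exact le_refl _⟩

end RawTerm

/-- The addition-free notation system `T`. -/
def T : Type := {a : RawTerm // a.InT}

/-- The order of the notation system `T`. -/
instance : LT T := ⟨fun a b => RawTerm.Lt a.1 b.1⟩

/-- `Tsub n m` is `T_n[m]`: the elements of `T` whose symbols `ϑ_j` all have `j < n` and which
satisfy `S ≤ m`. -/
def Tsub (n m : ℕ) : Set T := {a | a.1.LabelsLT n ∧ a.1.S ≤ (m : ℤ)}

/-- The element `ϑ_0 ϑ_1 … ϑ_n Ω_{n+1}` of `T`. -/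
def thetaOmega (n : ℕ) : T := ⟨RawTerm.tower 0 (n + 1), RawTerm.inT_tower 0 (n + 1)⟩

/-- The initial segment of `T` of all elements below `t`. -/
def below (t : T) : Set T := {a | a < t}

/-- The towers `ω_0[α] = α` and `ω_{n+1}[α] = ω ^ ω_n[α]`. -/
noncomputable def omegaTower (α : Ordinal.{0}) : ℕ → Ordinal.{0}
  | 0 => α
  | n + 1 => Ordinal.omega0 ^ omegaTower α n

end AddFreeTheta

/-! Totality of `<` is an induction on size. Well-foundedness comes from iterated accessible parts:
`ϑ_i` maps the accessible part of level `i + 1` into that of level `i` (`DistAcc.theta`), so every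
term is accessible. Transitivity is never proved for terms; it follows from well-foundedness and
trichotomy.

The two order types agree because the two sets are equal (`below_thetaOmega`): the tower has no
nonzero lower coefficients, so lying below it forces labels at most `n`, and conversely.

For the lower bound, ordinals `a < ω_n` are coded by strings of symbols with labels from `1` to `n`,
giving operations `f_a(y) = ϑ_0(code of a, ending in y)` on `T_{n+1}[0]`. These are inflationary and
increasing, and for `a < b` the segment below `f_b(y)` is closed under `f_a`. Such a family
satisfies `ω^(ω^ξ) * (1 + rank y) ≤ rank f_{1+ξ}(y)` (`opow_opow_mul_le_typein`). Letting `ξ` run up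
to `ω_n` gives `ω_{n+2}`. -/

namespace AddFreeTheta

namespace RawTerm

/-! ### Coefficients and totality of the order. -/

/-- The number of symbols `ϑ` in a term. -/
def size : RawTerm → ℕ
  | zero => 0
  | theta _ a => a.size + 1

theorem size_k_le (i : ℕ) (a : RawTerm) : (k i a).size ≤ a.size := by
  induction a with
  | zero => simp [k]
  | theta j b ih =>
    simp only [k]
    split_ifs
    · rfl
    · simp only [size]; omega

theorem neg_one_le_S (a : RawTerm) : -1 ≤ a.S := by
  cases a <;> simp only [S] <;> omega

theorem k_of_S_le {i : ℕ} {a : RawTerm} (h : a.S ≤ i) : k i a = a := by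
  cases a with
  | zero => rfl
  | theta j b =>
    simp only [S, Nat.cast_le] at h
    simp [k, h]

theorem S_k_le (i : ℕ) (a : RawTerm) : (k i a).S ≤ i := by
  induction a with
  | zero => simp only [k, S]; omega
  | theta j b ih =>
    simp only [k]
    split_ifs with h
    · simpa [S] using h
    · exact ih

theorem k_k {i j : ℕ} (h : j ≤ i) (a : RawTerm) : k j (k i a) = k j a := by
  induction a with
  | zero => rfl
  | theta l b ih =>
    by_cases hl : l ≤ i
    · simp [k, hl]
    · have : ¬ l ≤ j := by omega
      simp [k, hl, this, ih]

theorem k_theta_of_lt {i j : ℕ} (h : i < j) (a : RawTerm) : k i (theta j a) = k i a := by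
  simp [k, Nat.not_le.mpr h]

theorem InT.k {a : RawTerm} (h : a.InT) (i : ℕ) : (k i a).InT := by
  induction a with
  | zero => trivial
  | theta j b ih =>
    simp only [RawTerm.k]
    split_ifs
    · exact h
    · exact ih h.1

theorem LabelsLT.k {n : ℕ} {a : RawTerm} (h : a.LabelsLT n) (i : ℕ) : (k i a).LabelsLT n := by
  induction a with
  | zero => trivial
  | theta j b ih =>
    simp only [RawTerm.k]
    split_ifs
    · exact h
    · exact ih h.2

theorem lt_of_S_lt {a b : RawTerm} (h : a.S < b.S) : Lt a b := by
  cases a with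
  | zero => exact .zero_lt (by rintro rfl; exact lt_irrefl _ h)
  | theta i a =>
    cases b with
    | zero => simp only [S] at h; omega
    | theta j b => exact .index_lt (by simpa [S] using h)

theorem S_le_of_lt {a b : RawTerm} (h : Lt a b) : a.S ≤ b.S := by
  cases h with
  | zero_lt h => exact neg_one_le_S _
  | index_lt h => simpa [S] using h.le
  | arg_lt => exact le_rfl
  | eq_coeff => exact le_rfl
  | lt_coeff => exact le_rfl

theorem not_lt_zero (a : RawTerm) : ¬ Lt a zero := by
  intro h
  cases h with
  | zero_lt h => exact h rfl

theorem lt_trichotomy (a b : RawTerm) : Lt a b ∨ a = b ∨ Lt b a := by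
  induction hs : a.size + b.size using Nat.strong_induction_on generalizing a b with
  | _ s ih =>
    subst hs
    cases a with
    | zero =>
      by_cases h : b = zero
      · exact .inr (.inl h.symm)
      · exact .inl (.zero_lt h)
    | theta i a =>
      cases b with
      | zero => exact .inr (.inr (.zero_lt (by simp)))
      | theta j b =>
        rcases Nat.lt_trichotomy i j with h | rfl | h
        · exact .inl (.index_lt h)
        · have ha := size_k_le i a
          have hb := size_k_le i b
          rcases ih _ (by simp only [size]; omega) a b rfl with h | rfl | h
          · rcases ih _ (by simp only [size]; omega) (k i a) (theta i b) rfl with h' | h' | h'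
            · exact .inl (.arg_lt h h')
            · exact .inr (.inr (.eq_coeff h h'.symm))
            · exact .inr (.inr (.lt_coeff h h'))
          · exact .inr (.inl rfl)
          · rcases ih _ (by simp only [size]; omega) (k i b) (theta i a) rfl with h' | h' | h'
            · exact .inr (.inr (.arg_lt h h'))
            · exact .inl (.eq_coeff h h'.symm)
            · exact .inl (.lt_coeff h h')
        · exact .inr (.inr (.index_lt h))

/-- `z` is a subterm of the second argument that has the form `ϑ_0 u`. -/
def IsCoeff (z : RawTerm) : RawTerm → Prop
  | zero => False
  | theta j b => (j = 0 ∧ z = theta j b) ∨ IsCoeff z b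

theorem IsCoeff.eq_theta {z a : RawTerm} (h : IsCoeff z a) :
    ∃ u, z = theta 0 u ∧ z.size ≤ a.size := by
  induction a with
  | zero => exact h.elim
  | theta j b ih =>
    rcases h with ⟨rfl, rfl⟩ | h
    · exact ⟨b, rfl, le_rfl⟩
    · obtain ⟨u, hu, hs⟩ := ih h
      exact ⟨u, hu, hs.trans (Nat.le_succ _)⟩

theorem IsCoeff.trans {x y z : RawTerm} (h : IsCoeff x y) (h' : IsCoeff y z) : IsCoeff x z := by
  induction z with
  | zero => exact h'.elim
  | theta j b ih =>
    rcases h' with ⟨hj, rfl⟩ | h'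
    · exact h
    · exact .inr (ih h')

theorem k_zero_eq_zero_or_isCoeff (a : RawTerm) : k 0 a = zero ∨ IsCoeff (k 0 a) a := by
  induction a with
  | zero => exact .inl rfl
  | theta j b ih =>
    simp only [k, Nat.le_zero]
    split_ifs with h
    · exact .inr (.inl ⟨h, rfl⟩)
    · exact ih.imp_right .inr

theorem IsCoeff.eq_k_or {z a : RawTerm} (h : IsCoeff z a) :
    z = k 0 a ∨ ∃ b, k 0 a = theta 0 b ∧ IsCoeff z b := by
  induction a with
  | zero => exact h.elim
  | theta j b ih =>
    by_cases hj : j = 0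
    · subst hj
      rcases h with ⟨-, rfl⟩ | h
      · exact .inl rfl
      · exact .inr ⟨b, rfl, h⟩
    · rw [k_theta_of_lt (Nat.pos_of_ne_zero hj)]
      rcases h with ⟨h, -⟩ | h
      · exact absurd h hj
      · exact ih h

/-- Without transitivity, the claim for `k 0 a` alone does not carry an induction; for all subterms
`ϑ_0 u` it does, by induction on the size of `a` and then of `z`. -/
theorem IsCoeff.lt_theta {z a : RawTerm} (h : IsCoeff z a) : Lt z (theta 0 a) := by
  induction hs : a.size using Nat.strong_induction_on generalizing a z with
  | _ s ih =>
    induction ht : z.size using Nat.strong_induction_on generalizing z with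
    | _ t ih' =>
      obtain ⟨u, rfl, hu⟩ := h.eq_theta
      rcases lt_trichotomy u a with hua | rfl | hua
      · refine .arg_lt hua ?_
        rcases k_zero_eq_zero_or_isCoeff u with h0 | h0
        · rw [h0]; exact .zero_lt (by simp)
        · refine ih' _ ?_ (IsCoeff.trans (y := theta 0 u) (Or.inr h0) h) rfl
          · have := size_k_le 0 u
            rw [← ht]
            simp only [size]
            omega
      · simp [size] at hu
      · rcases h.eq_k_or with hk | ⟨b, hk, hb⟩
        · exact .eq_coeff hua hk
        · refine .lt_coeff hua ?_
          rw [hk]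
          refine ih b.size ?_ hb rfl
          have := size_k_le 0 a
          rw [hk] at this
          simp only [size] at this
          omega

theorem k_zero_lt_theta (a : RawTerm) : Lt (k 0 a) (theta 0 a) := by
  rcases k_zero_eq_zero_or_isCoeff a with h | h
  · rw [h]; exact .zero_lt (by simp)
  · exact h.lt_theta

/-! ### Well-foundedness by iterated accessible parts. -/

section Wellfounded

/-- The terms of `T` with labels below `n` and `S a ≤ i` all whose coefficients `k_j a` with `j < i`
lie in the accessible part of the sets so defined for `j`. -/
def Dist (n i : ℕ) (a : RawTerm) : Prop :=
  a.InT ∧ a.LabelsLT n ∧ a.S ≤ i ∧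
    ∀ j, j < i → Dist n j (k j a) ∧ Acc (fun x y => Lt x y ∧ Dist n j x) (k j a)
termination_by i

/-- The accessible part of `Dist n i`. -/
def DistAcc (n i : ℕ) (a : RawTerm) : Prop :=
  Dist n i a ∧ Acc (fun x y => Lt x y ∧ Dist n i x) a

theorem dist_iff {n i : ℕ} {a : RawTerm} : Dist n i a ↔
    a.InT ∧ a.LabelsLT n ∧ a.S ≤ i ∧ ∀ j, j < i → DistAcc n j (k j a) := by
  rw [Dist]; rfl

theorem DistAcc.of_lt {n i : ℕ} {a b : RawTerm} (ha : DistAcc n i a) (hb : Dist n i b)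
    (h : Lt b a) : DistAcc n i b :=
  ⟨hb, ha.2.inv ⟨h, hb⟩⟩

theorem Dist.of_le {n i j : ℕ} {a : RawTerm} (h : Dist n i a) (hj : j ≤ i) (hS : a.S ≤ j) :
    Dist n j a := by
  rw [dist_iff] at h ⊢
  exact ⟨h.1, h.2.1, hS, fun l hl => h.2.2.2 l (hl.trans_le hj)⟩

/-- A smaller term has no larger `S`, so raising the level adds no predecessors of `a`. -/
theorem DistAcc.succ {n i : ℕ} {a : RawTerm} (h : DistAcc n i a) : DistAcc n (i + 1) a := by
  obtain ⟨hd, hacc⟩ := h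
  refine ⟨?_, ?_⟩
  · have hd' := dist_iff.mp hd
    refine dist_iff.mpr ⟨hd'.1, hd'.2.1, by have := hd'.2.2.1; push_cast; omega, fun l hl => ?_⟩
    rcases Nat.lt_succ_iff_lt_or_eq.mp hl with hl | rfl
    · exact hd'.2.2.2 l hl
    · rw [k_of_S_le hd'.2.2.1]
      exact ⟨hd, hacc⟩
  · induction hacc with
    | intro a _ ih =>
      refine ⟨_, fun x hx => ?_⟩
      have hxi : Dist n i x :=
        hx.2.of_le (Nat.le_succ i) ((S_le_of_lt hx.1).trans (dist_iff.mp hd).2.2.1)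
      exact ih x ⟨hx.1, hxi⟩ hxi

theorem DistAcc.mono {n i j : ℕ} {a : RawTerm} (h : DistAcc n i a) (hj : i ≤ j) :
    DistAcc n j a := by
  induction hj with
  | refl => exact h
  | step _ ih => exact ih.succ

/-- Main induction on the accessibility of `a`, side induction on the size of a predecessor `ϑ_i c`.
If `c < a`, the side induction makes `k i c` accessible, which puts `c` in `Dist n (i + 1)`, and the
main induction applies. Otherwise `ϑ_i c ≤ k i a`, which is accessible by hypothesis. -/
theorem DistAcc.theta {n i : ℕ} {a : RawTerm} (hi : i < n) (h : DistAcc n (i + 1) a) :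
    DistAcc n i (theta i a) := by
  obtain ⟨hd, hacc⟩ := h
  induction hacc with
  | intro a _ ih =>
    have hd' := dist_iff.mp hd
    have hka : DistAcc n i (k i a) := hd'.2.2.2 i (Nat.lt_succ_self i)
    have hdist : Dist n i (RawTerm.theta i a) := by
      refine dist_iff.mpr ⟨⟨hd'.1, by simpa using hd'.2.2.1⟩, ⟨hi, hd'.2.1⟩, le_rfl,
        fun l hl => ?_⟩
      rw [k_theta_of_lt hl]
      exact hd'.2.2.2 l (hl.trans (Nat.lt_succ_self i))
    refine ⟨hdist, ⟨_, fun b hb => ?_⟩⟩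
    obtain ⟨hlt, hb⟩ := hb
    suffices DistAcc n i b from this.2
    induction hs : b.size using Nat.strong_induction_on generalizing b with
    | _ s ih' =>
      have hb' := dist_iff.mp hb
      have small (hS : b.S < i) : DistAcc n i b := by
        cases i with
        | zero =>
          have : b = zero := by
            cases b with
            | zero => rfl
            | theta j c => simp only [S] at hS; omega
          subst this
          exact ⟨hb, ⟨_, fun x hx => (not_lt_zero x hx.1).elim⟩⟩
        | succ m =>
          have := hb'.2.2.2 m (Nat.lt_succ_self m)
          rw [k_of_S_le (by push_cast at hS; omega)] at this
          exact this.succ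
      cases b with
      | zero => exact small (by simp only [S]; omega)
      | theta j c =>
        have hji : j ≤ i := by simpa [S] using hb'.2.2.1
        rcases hji.lt_or_eq with hji | rfl
        · exact small (by simpa [S] using hji)
        · have arg (hca : Lt c a) (hkc : Lt (k j c) (RawTerm.theta j a)) :
              DistAcc n j (RawTerm.theta j c) := by
            have hlow : ∀ l, l < j → DistAcc n l (k l c) := fun l hl => by
              simpa [k_theta_of_lt hl] using hb'.2.2.2 l hl
            have hkd : Dist n j (k j c) := dist_iff.mpr
              ⟨hb'.1.1.k j, hb'.2.1.2.k j, S_k_le j c, fun l hl => by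
                rw [k_k hl.le]; exact hlow l hl⟩
            have hk : DistAcc n j (k j c) := by
              refine ih' _ ?_ (k j c) hkc hkd rfl
              have := size_k_le j c
              rw [← hs]
              simp only [size]
              omega
            have hc : Dist n (j + 1) c := dist_iff.mpr
              ⟨hb'.1.1, hb'.2.1.2, by simpa using hb'.1.2, fun l hl => by
                rcases Nat.lt_succ_iff_lt_or_eq.mp hl with hl | rfl
                · exact hlow l hl
                · exact hk⟩
            exact ih c ⟨hca, hc⟩ hc
          cases hlt with
          | index_lt h => exact (lt_irrefl _ h).elim
          | arg_lt h hk => exact arg h hk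
          | eq_coeff h hk => rw [hk]; exact hka
          | lt_coeff h hk => exact hka.of_lt hb hk

theorem distAcc_k {n : ℕ} {a : RawTerm} (hT : a.InT) (hl : a.LabelsLT n) (i : ℕ) :
    DistAcc n i (k i a) := by
  induction a generalizing i with
  | zero =>
    have hz : DistAcc n 0 zero :=
      ⟨dist_iff.mpr ⟨trivial, trivial, by simp [S], fun l hl => (Nat.not_lt_zero l hl).elim⟩,
        ⟨_, fun x hx => (not_lt_zero x hx.1).elim⟩⟩
    exact hz.mono (Nat.zero_le i)
  | theta j b ih =>
    by_cases hji : j ≤ i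
    · have hb : DistAcc n (j + 1) b := by
        have := ih hT.1 hl.2 (j + 1)
        rwa [k_of_S_le (by simpa using hT.2)] at this
      simpa [k, hji] using (hb.theta hl.1).mono hji
    · simpa [k, hji] using ih hT.1 hl.2 i

end Wellfounded

end RawTerm

theorem Tsub_isWellOrder (n m : ℕ) : IsWellOrder (Tsub n m) (fun a b => a < b) := by
  have hdist (a : Tsub n m) : RawTerm.DistAcc n m a.1.1 := by
    have := RawTerm.distAcc_k a.1.2 a.2.1 m
    rwa [RawTerm.k_of_S_le a.2.2] at this
  have hwf : WellFounded (fun a b : Tsub n m => a < b) := by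
    refine ⟨fun a => ?_⟩
    obtain ⟨x, hx⟩ : ∃ x, x = a.1.1 := ⟨_, rfl⟩
    have hacc := (hdist a).2
    rw [← hx] at hacc
    induction hacc generalizing a with
    | intro x _ ih =>
      subst hx
      exact ⟨_, fun b hb => ih b.1.1 ⟨hb, (hdist b).1⟩ b rfl⟩
  have htri : Std.Trichotomous (fun a b : Tsub n m => a < b) := ⟨fun a b hab hba => by
    rcases RawTerm.lt_trichotomy a.1.1 b.1.1 with h | h | h
    · exact (hab h).elim
    · exact Subtype.ext (Subtype.ext h)
    · exact (hba h).elim⟩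
  exact { wf := hwf, trichotomous := htri.trichotomous }

/-! ### The segment below the tower. -/

namespace RawTerm

theorem lt_tower {n i : ℕ} {a : RawTerm} (hT : a.InT) (hl : a.LabelsLT (n + 1)) (hi : i ≤ n + 1)
    (hS : a.S ≤ i) : Lt a (tower i (n + 1 - i)) := by
  induction hs : a.size using Nat.strong_induction_on generalizing a i with
  | _ s ih =>
    rcases hS.lt_or_eq with hS | hS
    · exact lt_of_S_lt (by rwa [S_tower])
    · cases a with
      | zero => simp only [S] at hS; omega
      | theta j b =>
        obtain rfl : j = i := by simpa [S] using hS
        have hj : j ≤ n := Nat.lt_succ_iff.mp hl.1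
        have hb := size_k_le j b
        rw [Nat.sub_add_comm hj, tower]
        refine .arg_lt ?_ ?_
        · have := ih b.size (by rw [← hs]; exact Nat.lt_succ_self _) hT.1 hl.2
            (Nat.succ_le_succ hj) (by simpa using hT.2) rfl
          rwa [Nat.add_sub_add_right] at this
        · have := ih (k j b).size (by rw [← hs]; simp only [size]; omega) (hT.1.k j)
            (hl.2.k j) hi (S_k_le j b) rfl
          rwa [Nat.sub_add_comm hj, tower] at this

/-- Bounding every coefficient, not only `a`, is what passes to the argument of `ϑ_j`. -/
theorem labelsLT_of_k_lt_tower {n : ℕ} {a : RawTerm} (hT : a.InT) (hS : a.S ≤ n)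
    (h : ∀ i ≤ n, Lt (k i a) (tower i (n + 1 - i))) : a.LabelsLT (n + 1) := by
  induction a with
  | zero => trivial
  | theta j b ih =>
    have hj : j ≤ n := by simpa [S] using hS
    have hlt : Lt b (tower (j + 1) (n - j)) ∧ Lt (k j b) (tower j (n + 1 - j)) := by
      have := h j hj
      rw [Nat.sub_add_comm hj, tower] at this ⊢
      simp only [k, le_refl, if_true] at this
      -- All labels here exceed `j`, so neither coefficient clause can apply.
      have hk : k j (tower (j + 1) (n - j)) = zero := by
        generalize n - j = m
        have aux : ∀ (m i : ℕ), j < i → k j (tower i m) = zero := by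
          intro m
          induction m with
          | zero => intro i hi; simp [tower, Omega, k, Nat.not_le.mpr hi]
          | succ m ih =>
            intro i hi
            simp [tower, k, Nat.not_le.mpr hi, ih (i + 1) (by omega)]
        exact aux m (j + 1) (Nat.lt_succ_self j)
      cases this with
      | index_lt h => exact (lt_irrefl _ h).elim
      | arg_lt h1 h2 => exact ⟨h1, h2⟩
      | eq_coeff h1 h2 => rw [hk] at h2; cases h2
      | lt_coeff h1 h2 => rw [hk] at h2; exact (not_lt_zero _ h2).elim
    have hSb : b.S ≤ (j : ℤ) + 1 := hT.2
    refine ⟨Nat.lt_succ_iff.mpr hj, ih hT.1 ?_ fun i hi => ?_⟩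
    · rcases hj.lt_or_eq with hj | rfl
      · omega
      -- For `j = n` the bound on the argument is `Ω_{n+1}`, which excludes the label `n + 1`.
      · have h1 := hlt.1
        rw [Nat.sub_self] at h1
        cases h1 with
        | zero_lt => simp only [S]; omega
        | index_lt h => simp only [S]; omega
        | arg_lt h => exact (not_lt_zero _ h).elim
        | eq_coeff h hk => cases hk
        | lt_coeff h hk => exact (not_lt_zero _ hk).elim
    · rcases Nat.lt_trichotomy i j with hij | rfl | hij
      · simpa [k_theta_of_lt hij] using h i hi
      · exact hlt.2
      · rw [k_of_S_le (by omega)]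
        rcases Nat.succ_le_iff.mpr hij |>.lt_or_eq with hij | rfl
        · exact lt_of_S_lt (by rw [S_tower]; omega)
        · have := hlt.1
          rwa [Nat.add_sub_add_right]

end RawTerm

theorem below_thetaOmega (n : ℕ) : below (thetaOmega n) = Tsub (n + 1) 0 := by
  ext ⟨a, ha⟩
  constructor
  · intro h
    have h : RawTerm.Lt a (RawTerm.tower 0 (n + 1)) := h
    have hS : a.S ≤ ((0 : ℕ) : ℤ) := (RawTerm.S_le_of_lt h).trans (by rw [RawTerm.S_tower])
    have hS' : a.S ≤ 0 := hS
    suffices hl : a.LabelsLT (n + 1) from ⟨hl, hS⟩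
    refine RawTerm.labelsLT_of_k_lt_tower ha (by omega) fun i _ => ?_
    rw [RawTerm.k_of_S_le (by omega)]
    rcases Nat.eq_zero_or_pos i with rfl | hi
    · exact h
    · exact RawTerm.lt_of_S_lt (by rw [RawTerm.S_tower]; omega)
  · rintro ⟨hl, hS⟩
    exact RawTerm.lt_tower ha hl (Nat.zero_le _) hS

end AddFreeTheta
-- Ordinal arithmetic and ranks under collapsing operations.
open Ordinal

namespace AddFreeTheta

theorem sub_opow_log_lt {a : Ordinal.{0}} (ha : a ≠ 0) : a - ω ^ log ω a < a := by
  refine lt_of_le_of_ne (Ordinal.sub_le_self _ _) fun h => ?_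
  have h1 := Ordinal.add_sub_cancel_of_le (opow_log_le_self ω ha)
  rw [h] at h1
  rw [add_eq_right_iff_mul_omega0_le, ← opow_succ] at h1
  exact (lt_opow_succ_log_self one_lt_omega0 a).not_ge h1

theorem sub_opow_log_lt_sub {a b : Ordinal.{0}} (ha : a ≠ 0) (hab : a < b)
    (h : log ω a = log ω b) : a - ω ^ log ω a < b - ω ^ log ω b := by
  rw [← h, ← add_lt_add_iff_left (ω ^ log ω a),
    Ordinal.add_sub_cancel_of_le (opow_log_le_self ω ha),
    Ordinal.add_sub_cancel_of_le ((opow_log_le_self ω ha).trans hab.le)]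
  exact hab

/-- A bound that is closed under successor and under `ρ ↦ ω ^ ω ^ η * ρ` for `η < ξ` is closed under
addition of `ω ^ ω ^ ξ` up to equality. -/
theorem add_opow_opow_le {ξ R A : Ordinal.{0}} (hA : ω ^ ω ^ ξ ∣ A) (hAR : A < R)
    (hsucc : ∀ ρ < R, ρ + 1 < R) (hmul : ∀ η < ξ, ∀ ρ < R, ω ^ ω ^ η * ρ < R) :
    A + ω ^ ω ^ ξ ≤ R := by
  obtain ⟨σ, rfl⟩ := hA
  have key : ∀ x < ω ^ ω ^ ξ, ω ^ ω ^ ξ * σ + x < R := by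
    intro x hx
    rcases eq_or_ne ξ 0 with rfl | hξ
    · rw [opow_zero, opow_one] at hx
      obtain ⟨m, rfl⟩ := lt_omega0.mp hx
      clear hx
      induction m with
      | zero => simpa using hAR
      | succ m ih =>
        have := hsucc _ ih
        rwa [add_assoc, ← Nat.cast_succ] at this
    · obtain ⟨η, hη, m, hm⟩ := (lt_omega0_omega0_opow hξ).mp hx
      refine (add_le_add_right hm.le _).trans_lt ?_
      clear hm hx
      induction m with
      | zero => simpa using hsucc _ hAR
      | succ m ih =>
        have h1 := hmul η hη _ ih
        -- Left multiplication fixes the multiple of `ω ^ ω ^ ξ`, since `ω ^ η + ω ^ ξ = ω ^ ξ`, and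
        -- only enlarges the tail.
        have h2 : ω ^ ω ^ η * (ω ^ ω ^ ξ * σ) = ω ^ ω ^ ξ * σ := by
          rw [← mul_assoc, ← opow_add, add_of_omega0_opow_le ((opow_lt_opow_iff_right one_lt_omega0).mpr hη) le_rfl]
        rw [mul_add, h2, ← opow_add] at h1
        have h3 : ω ^ η + ω ^ η * (m : Ordinal.{0}) = ω ^ η * ((m + 1 : ℕ) : Ordinal.{0}) := by
          rw [Nat.add_comm, Nat.cast_add, Nat.cast_one, mul_one_add]
        rwa [h3] at h1
  exact (add_le_iff (opow_pos _ omega0_pos).ne').mpr key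

/-- Lower bounds for ranks in a well-order with a family of operations each of which collapses the
previous ones. -/
theorem opow_opow_mul_le_typein {α : Type} (r : α → α → Prop) [IsWellOrder α r]
    {l : Ordinal.{0}} (f : Ordinal.{0} → α → α)
    (hself : ∀ ξ < l, ∀ y, r y (f ξ y))
    (hmono : ∀ ξ < l, ∀ x y, r x y → r (f ξ x) (f ξ y))
    (hclosed : ∀ η ξ, η < ξ → ξ < l → ∀ z y, r z (f ξ y) → r (f η z) (f ξ y))
    {ξ : Ordinal.{0}} (hξ : 1 + ξ < l) (y : α) :
    ω ^ ω ^ ξ * (1 + typein r y) ≤ typein r (f (1 + ξ) y) := by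
  induction ξ using WellFoundedLT.induction generalizing y with
  | _ ξ ih =>
    -- `f 0` serves only to give closure under successor; hence the shift to index `1 + ξ`.
    have hsucc : ∀ y, ∀ ρ < typein r (f (1 + ξ) y), ρ + 1 < typein r (f (1 + ξ) y) := by
      intro y ρ hρ
      obtain ⟨z, rfl⟩ := typein_surj r (hρ.trans (typein_lt_type r _))
      have h1 := hclosed 0 (1 + ξ) (lt_of_lt_of_le zero_lt_one le_self_add) hξ z y
        ((typein_lt_typein r).mp hρ)
      have h2 := hself 0 (bot_le.trans_lt hξ) z
      exact (Order.add_one_le_of_lt ((typein_lt_typein r).mpr h2)).trans_lt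
        ((typein_lt_typein r).mpr h1)
    have hmul : ∀ y, ∀ η < ξ, ∀ ρ < typein r (f (1 + ξ) y),
        ω ^ ω ^ η * ρ < typein r (f (1 + ξ) y) := by
      intro y η hη ρ hρ
      obtain ⟨z, rfl⟩ := typein_surj r (hρ.trans (typein_lt_type r _))
      have hlt : 1 + η < 1 + ξ := (add_lt_add_iff_left 1).mpr hη
      refine lt_of_le_of_lt ?_ ((typein_lt_typein r).mpr
        (hclosed (1 + η) (1 + ξ) hlt hξ z y ((typein_lt_typein r).mp hρ)))
      exact (mul_le_mul_right le_add_self _).trans (ih η hη (hlt.trans hξ) z)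
    induction y using (IsWellFounded.wf (r := r)).induction with
    | _ y ihy =>
      rcases zero_or_succ_or_isSuccLimit (typein r y) with h0 | ⟨ρ, hρ⟩ | hlim
      · have := add_opow_opow_le (A := 0) (dvd_zero (ω ^ ω ^ ξ))
          (bot_le.trans_lt ((typein_lt_typein r).mpr (hself _ hξ y))) (hsucc y) (hmul y)
        rw [h0]
        simpa using this
      · have hρy : ρ < typein r y := hρ ▸ Order.lt_succ ρ
        obtain ⟨z, rfl⟩ := typein_surj r (hρy.trans (typein_lt_type r _))
        have hzy := (typein_lt_typein r).mp hρy
        have := add_opow_opow_le (dvd_mul_right (ω ^ ω ^ ξ) (1 + typein r z))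
          ((ihy z hzy).trans_lt ((typein_lt_typein r).mpr (hmono _ hξ z y hzy)))
          (hsucc y) (hmul y)
        rwa [← hρ, Order.succ_eq_add_one, ← add_assoc, mul_add_one]
      · rw [mul_le_iff_of_isSuccLimit (isSuccLimit_add 1 hlim)]
        intro b hb
        obtain ⟨d, hd, hbd⟩ := (lt_add_iff_of_isSuccLimit hlim).mp hb
        obtain ⟨z, rfl⟩ := typein_surj r (hd.trans (typein_lt_type r _))
        have hzy := (typein_lt_typein r).mp hd
        exact (mul_le_mul_right hbd.le _).trans
          ((ihy z hzy).trans ((typein_lt_typein r).mpr (hmono _ hξ z y hzy)).le)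

theorem omegaTower_isSuccLimit (n : ℕ) : Order.IsSuccLimit (omegaTower 1 (n + 1)) := by
  induction n with
  | zero => simp [omegaTower, isSuccLimit_omega0]
  | succ n ih => exact isSuccLimit_opow one_lt_omega0 ih

end AddFreeTheta

/-! ### Coding ordinals by terms. -/

namespace AddFreeTheta

/-- The term with labels in `[i, i + d)` that codes the Cantor normal form of `a`, with its innermost
`0` replaced by `y`. -/
noncomputable def enc : ℕ → ℕ → Ordinal.{0} → RawTerm → RawTerm
  | 0, _, _, y => y
  | d + 1, i, a, y =>
    if _h : a = 0 then y
    else .theta i (enc d (i + 1) (log ω a) (enc (d + 1) i (a - ω ^ log ω a) y))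
termination_by d _ a => (d, a)
decreasing_by
  · exact Prod.Lex.right _ (sub_opow_log_lt _h)
  · exact Prod.Lex.left _ _ (Nat.lt_succ_self d)

theorem enc_zero_right (d i : ℕ) (y : RawTerm) : enc d i 0 y = y := by
  cases d <;> simp [enc]

theorem enc_succ (d i : ℕ) {a : Ordinal.{0}} (h : a ≠ 0) (y : RawTerm) :
    enc (d + 1) i a y =
      .theta i (enc d (i + 1) (log ω a) (enc (d + 1) i (a - ω ^ log ω a) y)) := by
  rw [enc, dif_neg h]

theorem enc_rec {p : ℕ → ℕ → Ordinal.{0} → Prop} (h0 : ∀ i a, p 0 i a) (hz : ∀ d i, p (d + 1) i 0)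
    (h : ∀ d i a, a ≠ 0 → (∀ i a, p d i a) → (∀ b < a, p (d + 1) i b) → p (d + 1) i a)
    (d i : ℕ) (a : Ordinal.{0}) : p d i a := by
  induction d generalizing i a with
  | zero => exact h0 i a
  | succ d ihd =>
    induction a using WellFoundedLT.induction with
    | _ a iha =>
      rcases eq_or_ne a 0 with rfl | ha
      · exact hz d i
      · exact h d i a ha ihd iha

theorem S_enc (d i : ℕ) (a : Ordinal.{0}) {y : RawTerm} (hy : y.S ≤ i) : (enc d i a y).S ≤ i := by
  cases d with
  | zero => rwa [enc]
  | succ d =>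
    rcases eq_or_ne a 0 with rfl | ha
    · rwa [enc_zero_right]
    · rw [enc_succ d i ha]
      exact le_rfl

/-- Codes only add labels at least `i`, and `k j` with `j < i` skips them. -/
theorem k_enc (d i : ℕ) (a : Ordinal.{0}) : ∀ (y : RawTerm) (j : ℕ), j < i →
    (enc d i a y).k j = y.k j := by
  refine enc_rec (p := fun d i a => ∀ (y : RawTerm) (j : ℕ), j < i →
    (enc d i a y).k j = y.k j) ?_ ?_ ?_ d i a
  · intro i a y j _
    rw [enc]
  · intro d i y j _
    rw [enc_zero_right]
  · intro d i a ha ihd iha y j hj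
    rw [enc_succ d i ha, RawTerm.k_theta_of_lt hj, ihd _ _ _ _ (hj.trans (Nat.lt_succ_self i)),
      iha _ (sub_opow_log_lt ha) _ _ hj]

theorem inT_enc (d i : ℕ) (a : Ordinal.{0}) : ∀ y : RawTerm, y.InT → y.S ≤ i →
    (enc d i a y).InT := by
  refine enc_rec (p := fun d i a => ∀ y : RawTerm, y.InT → y.S ≤ i → (enc d i a y).InT)
    ?_ ?_ ?_ d i a
  · intro i a y hy _
    rwa [enc]
  · intro d i y hy _
    rwa [enc_zero_right]
  · intro d i a ha ihd iha y hy hS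
    have hS' : (enc (d + 1) i (a - ω ^ log ω a) y).S ≤ ((i + 1 : ℕ) : ℤ) :=
      (S_enc _ _ _ hS).trans (by simp)
    rw [enc_succ d i ha]
    exact ⟨ihd _ _ _ (iha _ (sub_opow_log_lt ha) _ hy hS) hS',
      by simpa using S_enc d (i + 1) (log ω a) hS'⟩

theorem labelsLT_enc (d i : ℕ) (a : Ordinal.{0}) : ∀ (y : RawTerm) (n : ℕ), y.LabelsLT n →
    i + d ≤ n → (enc d i a y).LabelsLT n := by
  refine enc_rec (p := fun d i a => ∀ (y : RawTerm) (n : ℕ), y.LabelsLT n →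
    i + d ≤ n → (enc d i a y).LabelsLT n) ?_ ?_ ?_ d i a
  · intro i a y n hy _
    rwa [enc]
  · intro d i y n hy _
    rwa [enc_zero_right]
  · intro d i a ha ihd iha y n hy hn
    rw [enc_succ d i ha]
    exact ⟨by omega, ihd _ _ _ _ (iha _ (sub_opow_log_lt ha) _ _ hy hn) (by omega)⟩

theorem log_lt_omegaTower {d : ℕ} {a : Ordinal.{0}} (h : a < omegaTower 1 (d + 1)) (ha : a ≠ 0) :
    log ω a < omegaTower 1 d :=
  (lt_opow_iff_log_lt one_lt_omega0 ha).mp h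

/-- The order of codes: the code of the smaller ordinal is smaller, whatever the arguments are, and
codes are increasing in their arguments. -/
theorem enc_lt_enc_and (d i : ℕ) :
    (∀ b < omegaTower 1 d, ∀ a < b, ∀ y z : RawTerm, y.S < i → z.S < i →
      (enc d i a y).Lt (enc d i b z)) ∧
    (∀ a < omegaTower 1 d, ∀ y z : RawTerm, y.S < i → z.S < i → y.Lt z →
      (enc d i a y).Lt (enc d i a z)) := by
  induction d generalizing i with
  | zero =>
    refine ⟨fun b hb a hab => ?_, fun a _ y z _ _ h => by simpa only [enc] using h⟩
    rw [omegaTower, Order.lt_one_iff] at hb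
    exact absurd (hb ▸ hab) not_lt_zero
  | succ d ihd =>
    obtain ⟨ih1, ih2⟩ := ihd (i + 1)
    have hS (a : Ordinal.{0}) {y : RawTerm} (hy : y.S < i) :
        (enc (d + 1) i a y).S < ((i + 1 : ℕ) : ℤ) :=
      (S_enc _ _ _ hy.le).trans_lt (by simp)
    have hk (a c : Ordinal.{0}) {y : RawTerm} (hy : y.S < i) :
        (enc d (i + 1) c (enc (d + 1) i a y)).k i = enc (d + 1) i a y := by
      rw [k_enc _ _ _ _ _ (Nat.lt_succ_self i), RawTerm.k_of_S_le (S_enc _ _ _ hy.le)]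
    have h1 : ∀ b < omegaTower 1 (d + 1), ∀ a < b, ∀ y z : RawTerm, y.S < i → z.S < i →
        (enc (d + 1) i a y).Lt (enc (d + 1) i b z) := by
      intro b hb a
      induction a using WellFoundedLT.induction generalizing b with
      | _ a iha =>
        intro hab y z hy hz
        have hb0 : b ≠ 0 := (bot_le.trans_lt hab).ne'
        rcases eq_or_ne a 0 with rfl | ha0
        · rw [enc_zero_right, enc_succ d i hb0]
          exact RawTerm.lt_of_S_lt hy
        · have hlt := sub_opow_log_lt ha0
          -- The `i`-coefficient of the argument is the code of the remainder of `a`, so this is the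
          -- coefficient condition.
          have hcoeff := iha _ hlt b hb (hlt.trans hab) y z hy hz
          rw [enc_succ d i hb0] at hcoeff ⊢
          rw [enc_succ d i ha0]
          refine .arg_lt ?_ (by rwa [hk _ _ hy])
          -- Leading exponents decide first; if they agree, the remainders do, through monotonicity
          -- in the innermost argument.
          rcases (log_mono_right ω hab.le).lt_or_eq with hlog | hlog
          · exact ih1 _ (log_lt_omegaTower hb hb0) _ hlog _ _ (hS _ hy) (hS _ hz)
          · have hsub := sub_opow_log_lt_sub ha0 hab hlog
            rw [hlog] at hsub hlt ⊢
            exact ih2 _ (log_lt_omegaTower hb hb0) _ _ (hS _ hy) (hS _ hz)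
              (iha _ hlt _ ((sub_opow_log_lt hb0).trans hb) hsub y z hy hz)
    refine ⟨h1, fun a ha => ?_⟩
    induction a using WellFoundedLT.induction with
    | _ a iha =>
      intro y z hy hz hyz
      rcases eq_or_ne a 0 with rfl | ha0
      · simpa only [enc_zero_right] using hyz
      · have hlt := sub_opow_log_lt ha0
        have hcoeff := h1 a ha _ hlt y z hy hz
        rw [enc_succ d i ha0] at hcoeff ⊢
        rw [enc_succ d i ha0]
        exact .arg_lt (ih2 _ (log_lt_omegaTower ha ha0) _ _ (hS _ hy) (hS _ hz)
          (iha _ hlt (hlt.trans ha) y z hy hz hyz)) (by rwa [hk _ _ hy])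

/-! ### The collapsing operations and the lower bound. -/

section Collapse

variable (n : ℕ)

/-- The operation `y ↦ ϑ_0 (enc n 1 a y)` on `T_{n+1}[0]`. -/
noncomputable def collapse (a : Ordinal.{0}) (y : Tsub (n + 1) 0) : Tsub (n + 1) 0 :=
  have hS : y.1.1.S ≤ ((1 : ℕ) : ℤ) := y.2.2.trans (by simp)
  ⟨⟨.theta 0 (enc n 1 a y.1.1), inT_enc n 1 a _ y.1.2 hS, by simpa using S_enc n 1 a hS⟩,
    ⟨Nat.succ_pos n, labelsLT_enc n 1 a _ _ y.2.1 (by omega)⟩, le_rfl⟩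

variable {n}

theorem S_lt_one (y : Tsub (n + 1) 0) : y.1.1.S < ((1 : ℕ) : ℤ) :=
  y.2.2.trans_lt (by simp)

theorem k_zero_enc (a : Ordinal.{0}) (y : Tsub (n + 1) 0) : (enc n 1 a y.1.1).k 0 = y.1.1 := by
  rw [k_enc n 1 a _ _ Nat.zero_lt_one, RawTerm.k_of_S_le y.2.2]

theorem lt_collapse (a : Ordinal.{0}) (y : Tsub (n + 1) 0) : y < collapse n a y := by
  have := RawTerm.k_zero_lt_theta (enc n 1 a y.1.1)
  rwa [k_zero_enc] at this

theorem collapse_lt_collapse {a : Ordinal.{0}} (ha : a < omegaTower 1 n) {x y : Tsub (n + 1) 0}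
    (h : x < y) : collapse n a x < collapse n a y := by
  refine RawTerm.Lt.arg_lt ((enc_lt_enc_and n 1).2 a ha _ _ (S_lt_one x) (S_lt_one y) h) ?_
  rw [k_zero_enc]
  have := Tsub_isWellOrder (n + 1) 0
  exact trans_of (fun a b : Tsub (n + 1) 0 => a < b) h (lt_collapse a y)

theorem collapse_lt_of_lt {a b : Ordinal.{0}} (hab : a < b) (hb : b < omegaTower 1 n)
    {x y : Tsub (n + 1) 0} (h : x < collapse n b y) : collapse n a x < collapse n b y := by
  refine RawTerm.Lt.arg_lt ((enc_lt_enc_and n 1).1 b hb a hab _ _ (S_lt_one x) (S_lt_one y)) ?_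
  rw [k_zero_enc]
  exact h

end Collapse

theorem omegaTower_le_type_Tsub (n : ℕ) (hn : 1 ≤ n)
    [IsWellOrder (Tsub (n + 1) 0) (fun a b => a < b)] :
    omegaTower 1 (n + 2) ≤ type (fun a b : Tsub (n + 1) 0 => a < b) := by
  obtain ⟨m, rfl⟩ := Nat.exists_eq_add_of_le' hn
  set r : Tsub (m + 1 + 1) 0 → Tsub (m + 1 + 1) 0 → Prop := fun a b => a < b
  have hlim := omegaTower_isSuccLimit m
  by_contra! hlt
  have hlt' : type r < ω ^ ω ^ omegaTower 1 (m + 1) := hlt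
  obtain ⟨δ, hδ, hr⟩ := (lt_opow_of_isSuccLimit omega0_ne_zero
    (isSuccLimit_opow one_lt_omega0 hlim)).mp hlt'
  obtain ⟨ξ, hξ, hδξ⟩ := (lt_opow_of_isSuccLimit omega0_ne_zero hlim).mp hδ
  -- `ω_{m+1}` is a power of `ω`, hence additively principal.
  have hξ' : 1 + ξ < omegaTower 1 (m + 1) :=
    isPrincipal_add_omega0_opow _ (one_lt_of_isSuccLimit hlim) hξ
  have h0 : Tsub (m + 1 + 1) 0 := ⟨⟨.zero, trivial⟩, trivial, by simp [RawTerm.S]⟩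
  have := opow_opow_mul_le_typein r (collapse (m + 1)) (fun ξ _ => lt_collapse ξ)
    (fun ξ hξ x y => collapse_lt_collapse hξ)
    (fun η ξ hη hξ z y => collapse_lt_of_lt hη hξ) hξ' h0
  refine (this.trans_lt (typein_lt_type r _)).not_ge (hr.le.trans ?_)
  calc ω ^ δ ≤ ω ^ ω ^ ξ := opow_le_opow_right omega0_pos hδξ.le
    _ ≤ ω ^ ω ^ ξ * (1 + typein r h0) := le_mul_left _ (zero_lt_one.trans_le le_self_add)

end AddFreeTheta

theorem mainTheorem2 (n : ℕ) (hn : 1 ≤ n) :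
    ∃ (_ : IsWellOrder (AddFreeTheta.below (AddFreeTheta.thetaOmega n)) (fun a b => a < b))
      (_ : IsWellOrder (AddFreeTheta.Tsub (n + 1) 0) (fun a b => a < b)),
      AddFreeTheta.omegaTower 1 (n + 2) ≤
          Ordinal.type (fun a b : AddFreeTheta.below (AddFreeTheta.thetaOmega n) => a < b) ∧
        AddFreeTheta.omegaTower 1 (n + 2) ≤
          Ordinal.type (fun a b : AddFreeTheta.Tsub (n + 1) 0 => a < b) ∧
        Ordinal.type (fun a b : AddFreeTheta.Tsub (n + 1) 0 => a < b) =
          Ordinal.type (fun a b : AddFreeTheta.below (AddFreeTheta.thetaOmega n) => a < b) := by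
  have h := AddFreeTheta.Tsub_isWellOrder (n + 1) 0
  have hle := AddFreeTheta.omegaTower_le_type_Tsub n hn
  rw [AddFreeTheta.below_thetaOmega n]
  exact ⟨h, h, hle, hle, rfl⟩
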